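/- Programs, inputs and outputs are finite strings over $\{0,1\}$, and $\perp$ is a special "don't know" symbol; the values $0,1$ of a characteristic function are regarded as one-letter strings. For a partial recursive mapping $U:\{0,1\}^*\times\{0,1\}^*\to\{0,1\}^*\cup\{\perp\}$, a set $A\subseteq\{0,1\}^*$ with characteristic function $\chi_A$, and $x\in\{0,1\}^*$, let - $C_U(x)=\min\{l(p): U(p,\lambda)=x\}$, where $l(p)$ is the length of $p$ and $\lambda$ is the empty string; - $\overline{ic}_U(x:A)$ be the least length $l(p)$ of a program $p$ such that $U(p,x)=\chi_A(x)$ and, for every $z$ for which $U(p,z)$ is defined, $U(p,z)\in\{\chi_A(z),\perp\}$; - $ic_U(x:A)$ be defined like $\overline{ic}_U(x:A)$, but admitting only those $p$ for which, in addition, $U(p,z)$ is defined for all $z$. In each case the value is $\infty$ if no such $p$ exists. Call a partial recursive $U$ optimal if for every partial recursive $V:\{0,1\}^*\times\{0,1\}^*\to\{0,1\}^*\cup\{\perp\}$ there is a constant $c$ such that $C_U(x)\le C_V(x)+c$, $ic_U(x:A)\le ic_V(x:A)+c$ and $\overline{ic}_U(x:A)\le\overline{ic}_V(x:A)+c$ for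 all $x$ and all $A$. Fix an optimal $U$ and write $C=C_U$ and $\overline{ic}=\overline{ic}_U$. **Theorem.** For every recursive function $f:\mathbb N\to\mathbb N$ there is an r.e. nonrecursive set $A\subseteq\{0,1\}^*$ such that $$f(\overline{ic}(x:A))\le C(x)\quad\text{for all but finitely many } x\in\{0,1\}^*$$ (in particular, $\overline{ic}(x:A)$ is finite for these $x$). -/

import Mathlib

namespace InstanceComplexity

/-- Interpreters: partial maps `{0,1}* × {0,1}* → {0,1}* ∪ {⊥}`, taking a program and an input.
`Part.none` means "undefined" and the value `none` is the "don't know" symbol `⊥`. -/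
abbrev Interpreter := List Bool → List Bool →. Option (List Bool)

/-- The characteristic function of `A`, with the values 0 and 1 as one-letter strings. -/
noncomputable def chi (A : Set (List Bool)) (x : List Bool) : List Bool :=
  open Classical in if x ∈ A then [true] else [false]

/-- A partial function `g` is `A`-consistent if each of its values is `χ_A` or `⊥`. -/
def Consistent (A : Set (List Bool)) (g : List Bool →. Option (List Bool)) : Prop :=
  ∀ z, ∀ v ∈ g z, v = some (chi A z) ∨ v = none

/-- Kolmogorov complexity `C_U(x)` (the infimum of the empty family is `∞`). -/
noncomputable def C (U : Interpreter) (x : List Bool) : ℕ∞ :=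
  ⨅ (p : List Bool) (_ : some x ∈ U p []), (p.length : ℕ∞)

/-- Instance complexity `ic_U(x : A)`: only total `A`-consistent programs are admitted. -/
noncomputable def ic (U : Interpreter) (A : Set (List Bool)) (x : List Bool) : ℕ∞ :=
  ⨅ (p : List Bool)
    (_ : (∀ z, (U p z).Dom) ∧ Consistent A (U p) ∧ some (chi A x) ∈ U p x),
    (p.length : ℕ∞)

/-- Weak instance complexity: as `ic`, but programs may be partial. -/
noncomputable def weakIc (U : Interpreter) (A : Set (List Bool)) (x : List Bool) : ℕ∞ :=
  ⨅ (p : List Bool) (_ : Consistent A (U p) ∧ some (chi A x) ∈ U p x), (p.length : ℕ∞)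

/-- An optimal partial recursive interpreter. -/
structure IsOptimal (U : Interpreter) : Prop where
  partrec : Partrec₂ U
  optimal : ∀ V : Interpreter, Partrec₂ V → ∃ c : ℕ,
    (∀ x, C U x ≤ C V x + c) ∧
    (∀ x A, ic U A x ≤ ic V A x + c) ∧
    (∀ x A, weakIc U A x ≤ weakIc V A x + c)

end InstanceComplexity

/-! The set A is built without injury. Requirement `e` puts at most one of its reserved strings `x`
into A, once `x` is seen in the `e`-th r.e. set, unless `x` has already been seen simple at a level
`≤ e`. Each level is finite (`finite_simpleAt`), so the restraint cannot stop `e`, and the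
complement of A is not r.e. (`not_rePred_notMem_witnesses`). Members of A have weak instance
complexity O(1), by enumeration. For `x` outside A whose first simple level is `k + 1`, the `k + 1`
bits telling which requirements `< k + 1` ever act suffice to reject `x` safely
(`notMem_witnesses_of_rejects`, `exists_rejects`). The complexity is then at most `k + 1 + O(1) ≤ 2
* k`, and non-simplicity at level `k` gives `f j ≤ C x` for all `j ≤ 2 * k`. -/

open Nat.Partrec Nat.Partrec.Code Encodable Filter

namespace InstanceComplexity

/-- The program with index `e` halts on input `n` within `t` steps. -/
def HaltsWithin (e t n : ℕ) : Prop := (evaln t (Denumerable.ofNat Code e) n).isSome = true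

theorem HaltsWithin.mono {e s t n : ℕ} (hst : s ≤ t) (h : HaltsWithin e s n) :
    HaltsWithin e t n := by
  obtain ⟨v, hv⟩ := Option.isSome_iff_exists.1 h
  exact Option.isSome_iff_exists.2 ⟨v, evaln_mono hst hv⟩

theorem primrecPred_haltsWithin :
    PrimrecPred fun a : ℕ × ℕ × ℕ => HaltsWithin a.1 a.2.1 a.2.2 := by
  refine PrimrecPred.of_eq (p := fun a : ℕ × ℕ × ℕ =>
    (evaln a.2.1 (Denumerable.ofNat Code a.1) a.2.2).isSome = true) ?_ fun _ => Iff.rfl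
  refine Primrec.eq.comp (Primrec.option_isSome.comp ?_) (Primrec.const true)
  exact primrec_evaln.comp (((Primrec.fst.comp Primrec.snd).pair
    ((Primrec.ofNat Code).comp Primrec.fst)).pair (Primrec.snd.comp Primrec.snd))

/-! ### R.e. predicates and projection. -/

section Enumerability

variable {α β : Type*} [Primcodable α] [Primcodable β]

theorem _root_.REPred.exists_haltsWithin {p : α → Prop} (hp : REPred p) :
    ∃ e, ∀ a, p a ↔ ∃ t, HaltsWithin e t (encode a) := by
  obtain ⟨c, hc⟩ := exists_code.1 hp
  refine ⟨encode c, fun a => ?_⟩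
  have h : p a ↔ ∃ v, v ∈ eval c (encode a) := by
    rw [hc]; simp
  rw [h]
  simp only [HaltsWithin, Denumerable.ofNat_encode, Option.isSome_iff_exists, evaln_complete]
  exact exists_comm

theorem rePred_exists_of_primrecPred {R : α → ℕ → Prop}
    (hR : PrimrecPred fun a : α × ℕ => R a.1 a.2) : REPred fun a => ∃ n, R a n := by
  classical
  have h : Partrec fun a => Nat.rfind fun n => Part.some (decide (R a n)) :=
    Partrec.rfind (p := fun a n => Part.some (decide (R a n))) hR.decide.to_comp.partrec
  refine h.dom_re.of_eq fun a => ?_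
  refine Nat.rfind_dom.trans ⟨fun ⟨n, hn, _⟩ => ⟨n, by simpa using hn⟩, fun ⟨n, hn⟩ => ?_⟩
  exact ⟨n, by simpa using hn, fun _ => trivial⟩

theorem _root_.REPred.exists {R : α → β → Prop} (hR : REPred fun a : α × β => R a.1 a.2) :
    REPred fun a => ∃ b, R a b := by
  obtain ⟨e, he⟩ := hR.exists_haltsWithin
  have hprim : PrimrecPred fun a : α × ℕ =>
      ((decode (α := β) a.2.unpair.1).map fun b =>
        (evaln a.2.unpair.2 (Denumerable.ofNat Code e) (encode (a.1, b))).isSome) = some true := by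
    refine Primrec.eq.comp ?_ (Primrec.const _)
    refine Primrec.option_map (Primrec.decode.comp
      (Primrec.fst.comp (Primrec.unpair.comp Primrec.snd))) ?_
    refine Primrec.option_isSome.comp (primrec_evaln.comp (Primrec.pair (Primrec.pair ?_ ?_) ?_))
    · exact Primrec.snd.comp (Primrec.unpair.comp (Primrec.snd.comp Primrec.fst))
    · exact Primrec.const _
    · exact Primrec.encode.comp (Primrec.pair (Primrec.fst.comp Primrec.fst) Primrec.snd)
  refine (rePred_exists_of_primrecPred (R := fun a n => ((decode (α := β) n.unpair.1).map fun b =>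
    (evaln n.unpair.2 (Denumerable.ofNat Code e) (encode (a, b))).isSome) = some true)
    hprim).of_eq fun a => ?_
  constructor
  · rintro ⟨n, hn⟩
    obtain ⟨b, -, hb⟩ := Option.map_eq_some_iff.1 hn
    exact ⟨b, (he (a, b)).2 ⟨_, hb⟩⟩
  · rintro ⟨b, hb⟩
    obtain ⟨t, ht⟩ := (he (a, b)).1 hb
    -- Dovetailing: one number codes both the witness and the running time.
    exact ⟨Nat.pair (encode b) t, by simpa [HaltsWithin] using ht⟩

end Enumerability

/-! ### The r.e. set and its restraints. -/

section Construction

/-- The string attended to at stage `t`; every string is attended to infinitely often. -/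
def attended (t : ℕ) : List Bool := (decode t.unpair.1).getD []

/-- The requirement to which a string is reserved. -/
def requirement (x : List Bool) : ℕ := x.length.unpair.1

theorem primrec_attended : Primrec attended :=
  Primrec.option_getD.comp (Primrec.decode.comp (Primrec.fst.comp Primrec.unpair))
    (Primrec.const [])

theorem primrec_requirement : Primrec requirement :=
  Primrec.fst.comp (Primrec.unpair.comp Primrec.list_length)

theorem exists_attended_eq (x : List Bool) (s : ℕ) : ∃ t, s ≤ t ∧ attended t = x :=
  ⟨Nat.pair (encode x) s, Nat.right_le_pair _ _, by simp [attended]⟩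

theorem infinite_requirement_eq (e : ℕ) : {x | requirement x = e}.Infinite := by
  refine Set.infinite_of_injective_forall_mem (f := fun m => List.replicate (Nat.pair e m) true)
    (fun m n h => ?_) fun m => by simp [requirement]
  have := congrArg List.length h
  simpa using this

variable (b : ℕ)

/-- At stage `t`, the attended string can serve as a witness for its requirement. Here `b` is an
index of the relation "`x` is simple at level `k`", which restrains the requirements `≥ k`. -/
def Eligible (t : ℕ) : Prop :=
  HaltsWithin (requirement (attended t)) t (encode (attended t)) ∧
    ∀ k < requirement (attended t) + 1, ¬ HaltsWithin b t (encode (attended t, k))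

/-- `t` is the first eligible stage for its requirement. -/
def Acts (t : ℕ) : Prop :=
  Eligible b t ∧ ∀ s < t, ¬ (Eligible b s ∧ requirement (attended s) = requirement (attended t))

/-- The set of all witnesses. -/
def witnesses : Set (List Bool) := {x | ∃ t, Acts b t ∧ attended t = x}

open Classical in
/-- Which of the requirements `< k` have acted before stage `t`. -/
noncomputable def state (k t : ℕ) : List Bool :=
  (List.range k).map fun e => decide (∃ s < t, Eligible b s ∧ requirement (attended s) = e)

/-- At stage `t`, the program `w` rejects `x`. -/
def Rejects (w x : List Bool) (t : ℕ) : Prop :=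
  HaltsWithin b t (encode (x, w.length)) ∧ w = state b w.length t ∧
    ∀ s < t, ¬ (Acts b s ∧ attended s = x)

theorem primrecPred_eligible : PrimrecPred (Eligible b) := by
  have hreq : Primrec fun t => requirement (attended t) :=
    primrec_requirement.comp primrec_attended
  refine PrimrecPred.and ?_ ?_
  · exact primrecPred_haltsWithin.comp
      (hreq.pair (Primrec.id.pair (Primrec.encode.comp primrec_attended)))
  · have h : PrimrecRel fun k t : ℕ => ¬ HaltsWithin b t (encode (attended t, k)) :=
      (primrecPred_haltsWithin.comp ((Primrec.const b).pair (Primrec.snd.pair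
        (Primrec.encode.comp ((primrec_attended.comp Primrec.snd).pair Primrec.fst))))).not
    exact h.forall_lt.comp (Primrec.succ.comp hreq) Primrec.id

theorem primrecRel_eligible_requirement :
    PrimrecRel fun s e : ℕ => Eligible b s ∧ requirement (attended s) = e :=
  ((primrecPred_eligible b).comp Primrec.fst).and (Primrec.eq.comp
    (primrec_requirement.comp (primrec_attended.comp Primrec.fst)) Primrec.snd)

theorem primrecPred_acts : PrimrecPred (Acts b) :=
  (primrecPred_eligible b).and ((primrecRel_eligible_requirement b).not.forall_lt.comp Primrec.id
    (primrec_requirement.comp primrec_attended))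

theorem primrecRel_acts_attended :
    PrimrecRel fun (s : ℕ) (x : List Bool) => Acts b s ∧ attended s = x :=
  ((primrecPred_acts b).comp Primrec.fst).and
    (Primrec.eq.comp (primrec_attended.comp Primrec.fst) Primrec.snd)

theorem rePred_witnesses : REPred fun x => x ∈ witnesses b :=
  rePred_exists_of_primrecPred (R := fun x t => Acts b t ∧ attended t = x)
    ((primrecRel_acts_attended b).comp Primrec.snd Primrec.fst)

theorem primrec_state : Primrec fun a : ℕ × ℕ => state b a.1 a.2 := by
  classical
  refine Primrec.list_map (Primrec.list_range.comp Primrec.fst) ?_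
  have h : PrimrecRel fun t e : ℕ => ∃ s < t, Eligible b s ∧ requirement (attended s) = e :=
    (primrecRel_eligible_requirement b).exists_lt
  exact h.decide.comp (Primrec.snd.comp Primrec.fst) Primrec.snd

theorem primrecPred_rejects :
    PrimrecPred fun a : (List Bool × List Bool) × ℕ => Rejects b a.1.1 a.1.2 a.2 := by
  have hw : Primrec fun a : (List Bool × List Bool) × ℕ => a.1.1 := Primrec.fst.comp Primrec.fst
  have hx : Primrec fun a : (List Bool × List Bool) × ℕ => a.1.2 := Primrec.snd.comp Primrec.fst
  have hk := Primrec.list_length.comp hw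
  refine PrimrecPred.and ?_ (PrimrecPred.and ?_ ?_)
  · exact primrecPred_haltsWithin.comp ((Primrec.const b).pair
      (Primrec.snd.pair (Primrec.encode.comp (hx.pair hk))))
  · exact Primrec.eq.comp hw ((primrec_state b).comp (hk.pair Primrec.snd))
  · have h : PrimrecRel fun (t : ℕ) (x : List Bool) => ∀ s < t, ¬ (Acts b s ∧ attended s = x) := by
      have h' : PrimrecRel fun (t : ℕ) (x : List Bool) => ∀ s ∈ List.range t,
          ¬ (Acts b s ∧ attended s = x) :=
        (primrecRel_acts_attended b).not.forall_mem_list.comp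
          (Primrec.list_range.comp Primrec.fst) Primrec.snd
      exact h'.of_eq fun t x => by simp
    exact h.comp Primrec.snd hx

theorem exists_acts_of_eligible {t : ℕ} (ht : Eligible b t) :
    ∃ s, Acts b s ∧ requirement (attended s) = requirement (attended t) := by
  classical
  have hex : ∃ s, Eligible b s ∧ requirement (attended s) = requirement (attended t) :=
    ⟨t, ht, rfl⟩
  obtain ⟨h₁, h₂⟩ := Nat.find_spec hex
  exact ⟨_, ⟨h₁, fun s hs h => Nat.find_min hex hs ⟨h.1, h.2.trans h₂⟩⟩, h₂⟩

open Classical in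
/-- Which of the requirements `< k` ever act. -/
noncomputable def limitState (k : ℕ) : List Bool :=
  (List.range k).map fun e => decide (∃ s, Eligible b s ∧ requirement (attended s) = e)

theorem eventually_state_eq (k : ℕ) : ∀ᶠ t in atTop, state b k t = limitState b k := by
  have h : ∀ e ∈ Finset.range k, ∀ᶠ t in atTop,
      ((∃ s < t, Eligible b s ∧ requirement (attended s) = e) ↔
        ∃ s, Eligible b s ∧ requirement (attended s) = e) := by
    intro e _
    by_cases he : ∃ s, Eligible b s ∧ requirement (attended s) = e
    · obtain ⟨s, hs⟩ := he
      filter_upwards [eventually_gt_atTop s] with t ht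
      exact ⟨fun _ => ⟨s, hs⟩, fun _ => ⟨s, ht, hs⟩⟩
    · exact Eventually.of_forall fun t => ⟨fun ⟨s, _, hs⟩ => ⟨s, hs⟩, fun h => (he h).elim⟩
  filter_upwards [(eventually_all_finset _).2 h] with t ht
  refine List.map_congr_left fun e he => ?_
  exact decide_eq_decide.2 (ht e (by simpa using he))

variable {b}

/-- After stage `t` no requirement can add `x`: those below `k` that ever act have already done so,
and those from `k` on are restrained by level `k`. -/
theorem notMem_witnesses_of_rejects {k t : ℕ} {x : List Bool}
    (h : Rejects b (limitState b k) x t) : x ∉ witnesses b := by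
  rintro ⟨s, hs, hsx⟩
  obtain ⟨hsimple, hstate, hnot⟩ := h
  have hlen : (limitState b k).length = k := by simp [limitState]
  rw [hlen] at hsimple hstate
  have hts : t ≤ s := not_lt.1 fun hst => hnot s hst ⟨hs, hsx⟩
  rcases lt_or_ge (requirement x) k with hk | hk
  · have he := List.map_inj_left.1 hstate (requirement x) (List.mem_range.2 hk)
    have hr : ∃ r < t, Eligible b r ∧ requirement (attended r) = requirement x :=
      (decide_eq_decide.1 he).1 ⟨s, hs.1, by rw [hsx]⟩
    obtain ⟨r, hr, hr'⟩ := hr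
    exact hs.2 r (hr.trans_le hts) (by rwa [hsx])
  · refine hs.1.2 k (by rw [hsx]; omega) ?_
    rw [hsx]
    exact hsimple.mono hts

/-- It is enough to wait until the state has converged. -/
theorem exists_rejects {k : ℕ} {x : List Bool} (hx : x ∉ witnesses b)
    (hk : ∃ t, HaltsWithin b t (encode (x, k))) : ∃ t, Rejects b (limitState b k) x t := by
  obtain ⟨t₀, ht₀⟩ := hk
  obtain ⟨t, ht, htt⟩ := ((eventually_state_eq b k).and (eventually_ge_atTop t₀)).exists
  have hlen : (limitState b k).length = k := by simp [limitState]
  refine ⟨t, ?_, ?_, fun s _ hs => hx ⟨s, hs⟩⟩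
  · rw [hlen]; exact ht₀.mono htt
  · rw [hlen, ht]

theorem not_rePred_notMem_witnesses
    (hfin : ∀ k : ℕ, {x : List Bool | ∃ t, HaltsWithin b t (encode (x, k))}.Finite) :
    ¬ REPred fun x => x ∉ witnesses b := by
  intro hre
  obtain ⟨e, he⟩ := hre.exists_haltsWithin
  by_cases hel : ∃ t, Eligible b t ∧ requirement (attended t) = e
  · obtain ⟨t, ht, rfl⟩ := hel
    obtain ⟨s, hs, hse⟩ := exists_acts_of_eligible b ht
    exact (he (attended s)).2 ⟨s, hse ▸ hs.1.1⟩ ⟨s, hs, rfl⟩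
  -- If `e` never acts, its infinitely many reserved strings all avoid A, and only finitely many are
  -- restrained; an unrestrained one would eventually become eligible.
  · have hfin' : (⋃ k ∈ Finset.range (e + 1),
        {x : List Bool | ∃ t, HaltsWithin b t (encode (x, k))}).Finite :=
      Set.Finite.biUnion (Finset.finite_toSet _) fun k _ => hfin k
    obtain ⟨x, hx, hx'⟩ := ((infinite_requirement_eq e).sdiff hfin').nonempty
    have hxA : x ∉ witnesses b := by
      rintro ⟨t, ht, rfl⟩
      exact hel ⟨t, ht.1, hx⟩
    obtain ⟨t₀, ht₀⟩ := (he x).1 hxA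
    obtain ⟨t, htt, rfl⟩ := exists_attended_eq x t₀
    have hx : requirement (attended t) = e := hx
    refine hel ⟨t, ⟨?_, fun k hk hkt => hx' ?_⟩, hx⟩
    · rw [hx]; exact ht₀.mono htt
    · rw [hx] at hk
      simp only [Set.mem_iUnion]
      exact ⟨k, Finset.mem_range.2 hk, t, hkt⟩

end Construction

/-! ### Upper bounds on weak instance complexity. -/

section Interpreters

/-- The interpreter that accepts the elements of `A`, whatever the program. -/
noncomputable def acceptor (A : Set (List Bool)) : Interpreter := fun _ x =>
  (Part.assert (x ∈ A) fun _ => Part.some ()).map fun _ => some [true]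

theorem partrec₂_acceptor {A : Set (List Bool)} (hA : REPred fun x => x ∈ A) :
    Partrec₂ (acceptor A) :=
  Partrec.map (Partrec.comp hA Computable.snd) (Computable.const _).to₂

theorem weakIc_acceptor {A : Set (List Bool)} {x : List Bool} (hx : x ∈ A) :
    weakIc (acceptor A) A x = 0 := by
  refine le_antisymm (iInf₂_le_of_le [] ⟨fun z v hv => ?_, ?_⟩ (by simp)) zero_le
  · simp only [acceptor, Part.mem_map_iff, Part.mem_assert_iff] at hv
    obtain ⟨_, ⟨hz, _⟩, rfl⟩ := hv
    simp [chi, hz]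
  · simp [acceptor, chi, hx]

/-- The interpreter that runs its programs as in `Rejects`. -/
noncomputable def rejector (b : ℕ) : Interpreter := fun w x =>
  (Part.assert (∃ t, Rejects b w x t) fun _ => Part.some ()).map fun _ => some [false]

theorem partrec₂_rejector (b : ℕ) : Partrec₂ (rejector b) :=
  Partrec.map (rePred_exists_of_primrecPred
    (R := fun (a : List Bool × List Bool) t => Rejects b a.1 a.2 t) (primrecPred_rejects b))
    (Computable.const _).to₂

theorem weakIc_rejector_le {b k : ℕ} {x : List Bool} (hx : x ∉ witnesses b)
    (hk : ∃ t, HaltsWithin b t (encode (x, k))) :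
    weakIc (rejector b) (witnesses b) x ≤ k := by
  refine iInf₂_le_of_le (limitState b k) ⟨fun z v hv => ?_, ?_⟩ (by simp [limitState])
  · simp only [rejector, Part.mem_map_iff, Part.mem_assert_iff] at hv
    obtain ⟨_, ⟨⟨t, hz⟩, _⟩, rfl⟩ := hv
    simp [chi, notMem_witnesses_of_rejects hz]
  · have := exists_rejects hx hk
    simp [rejector, chi, hx, this]

end Interpreters

/-! ### Levels of simplicity and the lower bound on `C`. -/

section Simplicity

/-- `x` has a description shorter than `f j + k` for some `j ≤ 2 * k`. -/
def SimpleAt (U : Interpreter) (f : ℕ → ℕ) (x : List Bool) (k : ℕ) : Prop :=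
  ∃ pj : List Bool × ℕ, some x ∈ U pj.1 [] ∧ pj.2 ≤ 2 * k ∧ pj.1.length < f pj.2 + k

variable {U : Interpreter} {f : ℕ → ℕ}

theorem SimpleAt.mono {x : List Bool} {k l : ℕ} (hkl : k ≤ l) (h : SimpleAt U f x k) :
    SimpleAt U f x l := by
  obtain ⟨pj, h₁, h₂, h₃⟩ := h
  exact ⟨pj, h₁, by omega, by omega⟩

theorem rePred_simpleAt (hU : Partrec₂ U) (hf : Computable f) :
    REPred fun a : List Bool × ℕ => SimpleAt U f a.1 a.2 := by
  refine REPred.exists (R := fun (a : List Bool × ℕ) (pj : List Bool × ℕ) =>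
    some a.1 ∈ U pj.1 [] ∧ pj.2 ≤ 2 * a.2 ∧ pj.1.length < f pj.2 + a.2) ?_
  let γ := ((List Bool × ℕ) × (List Bool × ℕ)) × Option (List Bool)
  have hcond : Computable fun g : γ => decide (g.2 = some g.1.1.1) &&
      (decide (g.1.2.2 ≤ 2 * g.1.1.2) && decide (g.1.2.1.length < f g.1.2.2 + g.1.1.2)) := by
    have hx : Computable fun g : γ => g.1.1.1 :=
      Computable.fst.comp (Computable.fst.comp Computable.fst)
    have hk : Computable fun g : γ => g.1.1.2 :=
      Computable.snd.comp (Computable.fst.comp Computable.fst)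
    have hp : Computable fun g : γ => g.1.2.1 :=
      Computable.fst.comp (Computable.snd.comp Computable.fst)
    have hj : Computable fun g : γ => g.1.2.2 :=
      Computable.snd.comp (Computable.snd.comp Computable.fst)
    refine Primrec.and.to_comp.comp ?_ (Primrec.and.to_comp.comp ?_ ?_)
    · exact Primrec.eq.decide.to_comp.comp Computable.snd (Computable.option_some.comp hx)
    · exact Primrec.nat_le.decide.to_comp.comp hj
        (Primrec.nat_mul.to_comp.comp (Computable.const 2) hk)
    · exact Primrec.nat_lt.decide.to_comp.comp (Computable.list_length.comp hp)
        (Primrec.nat_add.to_comp.comp (hf.comp hj) hk)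
  have hrun : Partrec fun a : (List Bool × ℕ) × (List Bool × ℕ) => U a.2.1 [] :=
    hU.comp (Computable.fst.comp Computable.snd) (Computable.const [])
  have hre : REPred fun g : γ => (decide (g.2 = some g.1.1.1) &&
      (decide (g.1.2.2 ≤ 2 * g.1.1.2) &&
        decide (g.1.2.1.length < f g.1.2.2 + g.1.1.2))) = true :=
    (ComputablePred.computable_iff.2 ⟨_, hcond, rfl⟩).to_re
  refine (Partrec.bind hrun (Partrec.to₂ hre)).dom_re.of_eq fun a => ?_
  simp [Part.dom_iff_mem]

/-- Only finitely many programs are short enough, and each describes at most one string. -/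
theorem finite_simpleAt (k : ℕ) : {x | SimpleAt U f x k}.Finite := by
  have hfin : (⋃ j ∈ Set.Iic (2 * k), {p : List Bool | p.length < f j + k}).Finite :=
    (Set.finite_Iic _).biUnion fun j _ => List.finite_length_lt Bool _
  refine (hfin.biUnion (t := fun p => {x | some x ∈ U p []}) fun p _ => ?_).subset ?_
  · refine Set.Subsingleton.finite fun x hx y hy => ?_
    exact Option.some_injective _ (Part.mem_unique hx hy)
  · rintro x ⟨⟨p, j⟩, h₁, h₂, h₃⟩
    simp only [Set.mem_iUnion]
    exact ⟨p, ⟨j, h₂, h₃⟩, h₁⟩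

theorem le_C_of_not_simpleAt {x : List Bool} {k j : ℕ} (h : ¬ SimpleAt U f x k)
    (hj : j ≤ 2 * k) : (f j : ℕ∞) ≤ C U x := by
  refine le_iInf₂ fun p hp => Nat.cast_le.2 (not_lt.1 fun hlt => h ⟨(p, j), hp, hj, ?_⟩)
  exact hlt.trans_le (Nat.le_add_right _ _)

theorem IsOptimal.exists_description (hU : IsOptimal U) (x : List Bool) :
    ∃ p, some x ∈ U p [] := by
  obtain ⟨c, hc, -⟩ := hU.optimal (fun p _ => Part.some (some p))
    (Computable.option_some.comp Computable.fst).partrec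
  by_contra! h
  have htop : C U x = ⊤ := by simp [C, h]
  have hle : C (fun p _ => Part.some (some p)) x ≤ x.length :=
    iInf₂_le_of_le x (Part.mem_some _) le_rfl
  have := (hc x).trans (add_le_add_left hle (c : ℕ∞))
  rw [htop, top_le_iff] at this
  exact ENat.natCast_ne_top (x.length + c) (by exact_mod_cast this)

theorem IsOptimal.exists_simpleAt (hU : IsOptimal U) (x : List Bool) :
    ∃ k, SimpleAt U f x k := by
  obtain ⟨p, hp⟩ := hU.exists_description x
  -- The summand `k` in the length bound exceeds any given length, even where `f` vanishes.
  exact ⟨p.length + 1, (p, 0), hp, Nat.zero_le _, by simp only; omega⟩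

theorem exists_weakIc_eq_of_le {A : Set (List Bool)} {x : List Bool} {k m : ℕ}
    (hm : weakIc U A x ≤ m) (hmk : m ≤ 2 * k) (h : ¬ SimpleAt U f x k) :
    ∃ n : ℕ, weakIc U A x = n ∧ (f n : ℕ∞) ≤ C U x := by
  obtain ⟨n, hn⟩ := ENat.ne_top_iff_exists.1 (ne_top_of_le_ne_top (ENat.natCast_ne_top m) hm)
  rw [← hn, Nat.cast_le] at hm
  exact ⟨n, hn.symm, le_C_of_not_simpleAt h (hm.trans hmk)⟩

end Simplicity

end InstanceComplexity

open InstanceComplexity in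
theorem mainTheorem9 (U : InstanceComplexity.Interpreter)
    (hU : InstanceComplexity.IsOptimal U) (f : ℕ → ℕ) (hf : Computable f) :
    ∃ A : Set (List Bool),
      REPred (fun x => x ∈ A) ∧ ¬ ComputablePred (fun x => x ∈ A) ∧
      ∀ᶠ x in Filter.cofinite, ∃ n : ℕ,
        InstanceComplexity.weakIc U A x = (n : ℕ∞) ∧
          ((f n : ℕ) : ℕ∞) ≤ InstanceComplexity.C U x := by
  classical
  obtain ⟨b, hb⟩ := (rePred_simpleAt hU.partrec hf).exists_haltsWithin
  have hfin (k : ℕ) : {x : List Bool | ∃ t, HaltsWithin b t (encode (x, k))}.Finite :=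
    (finite_simpleAt (U := U) (f := f) k).subset fun x hx => (hb (x, k)).2 hx
  obtain ⟨c₁, -, -, hc₁⟩ := hU.optimal _ (partrec₂_acceptor (rePred_witnesses b))
  obtain ⟨c₂, -, -, hc₂⟩ := hU.optimal _ (partrec₂_rejector b)
  refine ⟨witnesses b, rePred_witnesses b,
    fun h => not_rePred_notMem_witnesses hfin h.not.to_re, ?_⟩
  -- Discarding this level makes `k > c₁ + c₂` below, so that `2 * k` absorbs the constants.
  filter_upwards [(finite_simpleAt (U := U) (f := f) (c₁ + c₂ + 1)).compl_mem_cofinite] with x hx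
  have hx : ¬ SimpleAt U f x (c₁ + c₂ + 1) := hx
  by_cases hxA : x ∈ witnesses b
  · refine exists_weakIc_eq_of_le (m := c₁) ?_ (by omega) hx
    simpa [weakIc_acceptor hxA] using hc₁ x (witnesses b)
  · have hex := hU.exists_simpleAt (f := f) x
    obtain ⟨k, hk⟩ : ∃ k, Nat.find hex = k + 1 :=
      Nat.exists_eq_add_one.2 (Nat.pos_of_ne_zero fun h0 =>
        hx ((h0 ▸ Nat.find_spec hex).mono (Nat.zero_le _)))
    have hle : c₁ + c₂ + 1 < k + 1 := not_le.1 fun h => hx ((hk ▸ Nat.find_spec hex).mono h)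
    -- Minimality of `k + 1` is used twice: simplicity there bounds the complexity, its failure at
    -- `k` bounds `C x` from below.
    refine exists_weakIc_eq_of_le (k := k) (m := k + 1 + c₂) ?_ (by omega)
      (Nat.find_min hex (by omega))
    have hsimple := (hb (x, k + 1)).1 (hk ▸ Nat.find_spec hex)
    exact_mod_cast (hc₂ x (witnesses b)).trans
      (add_le_add_left (weakIc_rejector_le hxA hsimple) _)
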